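/- Let $H$ be a separable infinite-dimensional complex Hilbert space with orthonormal basis $\{e_j\}_{j\in\mathbb N}$, let $p\in B(H)$ be an orthogonal projection, and put $d_j=\langle p e_j,e_j\rangle$, $$a=\sum_{d_j\le 1/2} d_j,\qquad b=\sum_{d_j>1/2}(1-d_j).$$ Suppose that $a+b<\infty$, and let $q$ be the orthogonal projection onto the closed linear span of $\{e_j : d_j>1/2\}$. Then $p-q$ is a Hilbert–Schmidt operator, the operator $q|_{pH}\in B(pH,qH)$ is Fredholm, and $$a-b=[p:q]=\operatorname{ind}\big(q|_{pH}\big).$$ Here $\operatorname{ind} T=\dim\ker T-\dim\operatorname{coker}T$, and the essential codimension $[p:q]$ of two projections with $p-q$ compact is $\operatorname{tr}(p)-\operatorname{tr}(q)$ if both traces are finite, and $\operatorname{ind}(v^*w)$ if both are infinite, where $w,v\in B(H)$ are isometries with $ww^*=p$ and $vv^*=q$. -/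

import Mathlib

open scoped ENNReal

noncomputable section

namespace EssCodim

variable {H : Type*} [NormedAddCommGroup H] [InnerProductSpace ℂ H]

/-- The diagonal `d_j = ⟨p e_j, e_j⟩` of `p` in the orthonormal basis `e`; it is used for
self-adjoint `p`, for which these numbers are real. -/
def diag (e : HilbertBasis ℕ ℂ H) (p : H →L[ℂ] H) (j : ℕ) : ℝ :=
  (inner ℂ (e j) (p (e j))).re

/-- `a = ∑_{d_j ≤ 1/2} d_j`, as an element of `[0, ∞]`. -/
def kadisonA (e : HilbertBasis ℕ ℂ H) (p : H →L[ℂ] H) : ℝ≥0∞ :=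
  ∑' j : {j : ℕ // diag e p j ≤ 1 / 2}, ENNReal.ofReal (diag e p j)

/-- `b = ∑_{d_j > 1/2} (1 - d_j)`, as an element of `[0, ∞]`. -/
def kadisonB (e : HilbertBasis ℕ ℂ H) (p : H →L[ℂ] H) : ℝ≥0∞ :=
  ∑' j : {j : ℕ // 1 / 2 < diag e p j}, ENNReal.ofReal (1 - diag e p j)

/-- The orthogonal projection onto the closed linear span of the `e_j` with `d_j > 1/2`. -/
def largeDiagProj [CompleteSpace H] (e : HilbertBasis ℕ ℂ H) (p : H →L[ℂ] H) : H →L[ℂ] H :=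
  (Submodule.span ℂ (e '' {j : ℕ | 1 / 2 < diag e p j})).topologicalClosure.starProjection

/-- `T` is a Hilbert–Schmidt operator: `∑ ‖T e_i‖² < ∞` for an orthonormal basis `(e_i)` of the
Hilbert space (the sum does not depend on the basis; every basis can be indexed by the set of
its vectors). -/
def IsHilbertSchmidt (T : H →L[ℂ] H) : Prop :=
  ∃ (s : Set H) (e : HilbertBasis s ℂ H), Summable fun i : s => ‖T (e i)‖ ^ 2

/-- The operator `q|_{pH}`, as an element of `B(pH, qH)`. -/
def restrictRange (p q : H →L[ℂ] H) : p.range →L[ℂ] q.range :=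
  (q ∘L p.range.subtypeL).codRestrict q.range fun x => ⟨(x : H), rfl⟩

/-- `n` is the essential codimension `[p : q]` of the projections `p` and `q` with compact
difference: `tr p - tr q` if both are finite (the trace of a projection being the dimension of its
range), and the Fredholm index of `v* w` with `w`, `v` isometries satisfying `w w* = p`,
`v v* = q` if both are infinite. -/
def HasEssCodim [CompleteSpace H] (p q : H →L[ℂ] H) (n : ℤ) : Prop :=
  IsCompactOperator (p - q) ∧
    ((FiniteDimensional ℂ p.range ∧ FiniteDimensional ℂ q.range ∧
        n = (Module.finrank ℂ p.range : ℤ) - (Module.finrank ℂ q.range : ℤ)) ∨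
      (¬ FiniteDimensional ℂ p.range ∧ ¬ FiniteDimensional ℂ q.range ∧
        ∃ w v : H →L[ℂ] H, Isometry w ∧ Isometry v ∧
          w ∘L w.adjoint = p ∧ v ∘L v.adjoint = q ∧
          (v.adjoint ∘L w).IsFredholm ∧ n = (v.adjoint ∘L w).toLinearMap.index))

end EssCodim

end

/-! Let T = q|_{pH}, so T* = p|_{qH}. Then 1 - T*T = S*S and 1 - TT* = S'*S' with S = (1-q)|_{pH}
and S' = (1-p)|_{qH}. Hilbert–Schmidt sums are invariant under adjoints, so the traces can be read
off in the basis e. Each e_j is fixed or killed by q, so the traces are a and b (`kadisonA_eq`,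
`kadisonB_eq`). Likewise ‖(p-q)e_j‖² is d_j or 1 - d_j, so p - q is Hilbert–Schmidt.

The core is `isFredholm_and_index_eq`. S*S is compact, so T*T has an orthonormal eigenbasis. Off the
kernels, T*T and TT* share their eigenvalues with multiplicity, so the traces of 1 - T*T and 1 - TT*
cancel there. What remains is dim ker T - dim ker T*. The nonzero eigenvalues are bounded away from
0, which makes T Fredholm with this index.

Finally, v*w is T up to unitary identifications of H with pH and qH (`hasEssCodim_index`). -/

namespace EssCodim

universe u

/-! ### Hilbert–Schmidt sums, compactness and eigenbases. -/

section HilbertSchmidt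

variable {ι κ E F : Type*} [NormedAddCommGroup E] [InnerProductSpace ℂ E]
  [NormedAddCommGroup F] [InnerProductSpace ℂ F]

theorem ofReal_norm_sq {E : Type*} [NormedAddCommGroup E] (x : E) :
    ENNReal.ofReal (‖x‖ ^ 2) = ‖x‖ₑ ^ 2 := by
  rw [ENNReal.ofReal_pow (norm_nonneg x), ofReal_norm]

theorem hasSum_norm_inner_sq (b : HilbertBasis ι ℂ E) (x : E) :
    HasSum (fun i => ‖inner ℂ (b i) x‖ ^ 2) (‖x‖ ^ 2) := by
  have h := Complex.hasSum_re (b.hasSum_inner_mul_inner x x)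
  convert h using 1
  · funext i
    rw [← inner_conj_symm x (b i), ← Complex.normSq_eq_conj_mul_self, Complex.ofReal_re,
      Complex.normSq_eq_norm_sq]
  · exact (inner_self_eq_norm_sq (𝕜 := ℂ) x).symm

theorem tsum_enorm_inner_sq (b : HilbertBasis ι ℂ E) (x : E) :
    ∑' i, ‖inner ℂ (b i) x‖ₑ ^ 2 = ‖x‖ₑ ^ 2 := by
  have h := hasSum_norm_inner_sq b x
  rw [← ofReal_norm_sq x, ← h.tsum_eq, ENNReal.ofReal_tsum_of_nonneg (fun i => by positivity)
    h.summable]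
  simp only [ofReal_norm_sq]

theorem tsum_enorm_adjoint_sq [CompleteSpace E] [CompleteSpace F] (b : HilbertBasis ι ℂ E)
    (c : HilbertBasis κ ℂ F) (T : E →L[ℂ] F) :
    ∑' k, ‖T.adjoint (c k)‖ₑ ^ 2 = ∑' i, ‖T (b i)‖ₑ ^ 2 := by
  simp only [← tsum_enorm_inner_sq b (T.adjoint _), ← tsum_enorm_inner_sq c (T _)]
  rw [ENNReal.tsum_comm]
  refine tsum_congr fun i => tsum_congr fun k => ?_
  rw [ContinuousLinearMap.adjoint_inner_right, ← ofReal_norm, ← ofReal_norm, norm_inner_symm]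

theorem tsum_enorm_sq_eq [CompleteSpace E] [CompleteSpace F] {ι' : Type*} (b : HilbertBasis ι ℂ E)
    (b' : HilbertBasis ι' ℂ E) (T : E →L[ℂ] F) :
    ∑' i, ‖T (b i)‖ₑ ^ 2 = ∑' i, ‖T (b' i)‖ₑ ^ 2 := by
  obtain ⟨w, c, -⟩ := exists_hilbertBasis ℂ F
  rw [← tsum_enorm_adjoint_sq b c, ← tsum_enorm_adjoint_sq b' c]

/-- Expanding T*y in b and applying Cauchy–Schwarz bounds T*; the identity ‖Tx‖² = ⟨T*Tx, x⟩ carries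
the bound over to T. -/
theorem enorm_sq_le_tsum [CompleteSpace E] [CompleteSpace F] (b : HilbertBasis ι ℂ E)
    (T : E →L[ℂ] F) (x : E) : ‖T x‖ₑ ^ 2 ≤ (∑' i, ‖T (b i)‖ₑ ^ 2) * ‖x‖ₑ ^ 2 := by
  have key (y : F) : ‖T.adjoint y‖ₑ ^ 2 ≤ (∑' i, ‖T (b i)‖ₑ ^ 2) * ‖y‖ₑ ^ 2 := by
    rw [← tsum_enorm_inner_sq b, ← ENNReal.tsum_mul_right]
    refine ENNReal.tsum_le_tsum fun i => ?_
    rw [ContinuousLinearMap.adjoint_inner_right, ← mul_pow]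
    gcongr
    rw [← ofReal_norm, ← ofReal_norm, ← ofReal_norm,
      ← ENNReal.ofReal_mul (norm_nonneg _)]
    exact ENNReal.ofReal_le_ofReal (norm_inner_le_norm _ _)
  by_cases hT : T x = 0
  · simp [hT]
  have h1 : ‖T x‖ₑ ^ 2 ≤ ‖T.adjoint (T x)‖ₑ * ‖x‖ₑ := by
    rw [← ofReal_norm_sq, ← ofReal_norm, ← ofReal_norm,
      ← ENNReal.ofReal_mul (norm_nonneg _)]
    refine ENNReal.ofReal_le_ofReal ?_
    rw [← inner_self_eq_norm_sq (𝕜 := ℂ), ← ContinuousLinearMap.adjoint_inner_left]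
    exact (Complex.re_le_norm _).trans (norm_inner_le_norm _ _)
  have h2 : (‖T x‖ₑ ^ 2) ^ 2 ≤ ((∑' i, ‖T (b i)‖ₑ ^ 2) * ‖x‖ₑ ^ 2) * ‖T x‖ₑ ^ 2 :=
    calc (‖T x‖ₑ ^ 2) ^ 2 ≤ (‖T.adjoint (T x)‖ₑ * ‖x‖ₑ) ^ 2 := by gcongr
      _ = ‖T.adjoint (T x)‖ₑ ^ 2 * ‖x‖ₑ ^ 2 := mul_pow _ _ _
      _ ≤ ((∑' i, ‖T (b i)‖ₑ ^ 2) * ‖T x‖ₑ ^ 2) * ‖x‖ₑ ^ 2 := by gcongr; exact key _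
      _ = _ := by ring
  rw [sq (‖T x‖ₑ ^ 2)] at h2
  exact (ENNReal.mul_le_mul_iff_left (by simpa using hT) (by simp)).1 h2

theorem isCompactOperator_smulRight (φ : E →L[ℂ] ℂ) (y : F) :
    IsCompactOperator (φ.smulRight y) :=
  (isCompactOperator_of_locallyCompactSpace_dom φ).clm_comp
    (ContinuousLinearMap.toSpanSingleton ℂ y)

/-- T is a norm limit of its finite-rank truncations: the error is at most the square root of the
tail of the Hilbert–Schmidt sum. -/
theorem isCompactOperator_of_tsum_ne_top [CompleteSpace E] [CompleteSpace F]
    (b : HilbertBasis ι ℂ E) (T : E →L[ℂ] F) (h : ∑' i, ‖T (b i)‖ₑ ^ 2 ≠ ∞) :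
    IsCompactOperator T := by
  classical
  let A : Finset ι → E →L[ℂ] F := fun s =>
    ∑ i ∈ s, (innerSL ℂ (b i)).smulRight (T (b i))
  have hA (s : Finset ι) : IsCompactOperator (A s) :=
    Submodule.sum_mem (compactOperator (RingHom.id ℂ) E F)
      fun i _ => isCompactOperator_smulRight (innerSL ℂ (b i)) (T (b i))
  have hb (s : Finset ι) (j : ι) : A s (b j) = if j ∈ s then T (b j) else 0 := by
    simp [A, orthonormal_iff_ite.1 b.orthonormal]
  refine isCompactOperator_of_tendsto (F := A) (l := Filter.atTop) ?_ (.of_forall hA)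
  rw [tendsto_iff_norm_sub_tendsto_zero]
  have ht := ENNReal.tendsto_tsum_compl_atTop_zero h
  have hbound (s : Finset ι) : ‖A s - T‖ ≤
      Real.sqrt (∑' i : {i // i ∉ s}, ‖T (b i)‖ₑ ^ 2).toReal := by
    have hfin : ∑' i : {i // i ∉ s}, ‖T (b i)‖ₑ ^ 2 ≠ ∞ :=
      ne_top_of_le_ne_top h (ENNReal.tsum_comp_le_tsum_of_injective Subtype.val_injective _)
    refine ContinuousLinearMap.opNorm_le_bound _ (Real.sqrt_nonneg _) fun x => ?_
    have h1 := enorm_sq_le_tsum b (A s - T) x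
    have h2 : ∑' i, ‖(A s - T) (b i)‖ₑ ^ 2 = ∑' i : {i // i ∉ s}, ‖T (b i)‖ₑ ^ 2 := by
      rw [show (∑' i : {i // i ∉ s}, ‖T (b i)‖ₑ ^ 2) = ∑' i : ({i | i ∉ s} : Set ι),
        ‖T (b i)‖ₑ ^ 2 from rfl, tsum_subtype {i | i ∉ s} fun i => ‖T (b i)‖ₑ ^ 2]
      refine tsum_congr fun i => ?_
      by_cases hi : i ∈ s <;> simp [hb, hi]
    rw [h2] at h1
    have h3 := ENNReal.toReal_mono (ENNReal.mul_ne_top hfin (by simp)) h1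
    rw [ENNReal.toReal_mul, ENNReal.toReal_pow, ENNReal.toReal_pow, toReal_enorm,
      toReal_enorm] at h3
    rw [← Real.sqrt_sq (norm_nonneg x), ← Real.sqrt_mul ENNReal.toReal_nonneg]
    exact Real.le_sqrt_of_sq_le h3
  refine squeeze_zero (fun _ => norm_nonneg _) hbound ?_
  have := (Real.continuous_sqrt.tendsto _).comp
    ((ENNReal.tendsto_toReal ENNReal.zero_ne_top).comp ht)
  simpa [Function.comp_def] using this

/-- A compact symmetric operator on a Hilbert space has a Hilbert basis of eigenvectors. -/
theorem exists_hilbertBasis_eigenvectors {E : Type u} [NormedAddCommGroup E]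
    [InnerProductSpace ℂ E] [CompleteSpace E] {T : E →L[ℂ] E}
    (hT : IsCompactOperator T) (hT' : T.IsSymmetric) :
    ∃ (ι : Type u) (b : HilbertBasis ι ℂ E) (μ : ι → ℂ), ∀ i, T (b i) = μ i • b i := by
  let V : ℂ → Submodule ℂ E := fun μ => Module.End.eigenspace (T : Module.End ℂ E) μ
  have hV (μ : ℂ) : IsClosed (V μ : Set E) := by
    have : (V μ : Set E) = {x | T x = μ • x} := by
      ext x; simp [V]
    rw [this]
    exact isClosed_eq T.continuous (continuous_const_smul μ)
  have (μ : ℂ) : CompleteSpace (V μ) := (hV μ).completeSpace_coe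
  choose w b hb using fun μ => exists_hilbertBasis ℂ (V μ)
  have hv : Orthonormal ℂ fun a : Σ μ, w μ => ((b a.1 a.2 : V a.1) : E) :=
    hT'.orthogonalFamily_eigenspaces.orthonormal_sigma_orthonormal fun μ => (b μ).orthonormal
  refine ⟨_, HilbertBasis.mkOfOrthogonalEqBot hv ?_, fun a => a.1, fun a => ?_⟩
  · rw [eq_bot_iff, ← T.orthogonalComplement_iSup_eigenspaces_eq_bot hT hT']
    intro x hx
    rw [Submodule.mem_orthogonal] at hx
    rw [← Submodule.iInf_orthogonal, Submodule.mem_iInf]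
    intro μ
    change x ∈ (V μ)ᗮ
    rw [← Submodule.orthogonalProjectionOnto_eq_zero_iff]
    rw [← norm_eq_zero, ← sq_eq_zero_iff]
    -- By Parseval, the projection of x to the eigenspace vanishes once all its coefficients do.
    refine (hasSum_norm_inner_sq (b μ) _).unique ?_
    convert hasSum_zero with i
    rw [Submodule.inner_orthogonalProjectionOnto_eq_of_mem_left]
    simp [hx _ (Submodule.subset_span ⟨⟨μ, i⟩, rfl⟩)]
  · rw [HilbertBasis.coe_mkOfOrthogonalEqBot]
    exact Module.End.mem_eigenspace_iff.1 (b a.1 a.2).2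

theorem finrank_eq_card_of_forall_inner_eq_zero (b : HilbertBasis ι ℂ E) (K : Submodule ℂ E)
    (P : Set ι) [Finite P] (hP : ∀ i ∈ P, b i ∈ K) (hK : ∀ x ∈ K, ∀ i ∉ P, inner ℂ (b i) x = 0) :
    FiniteDimensional ℂ K ∧ Module.finrank ℂ K = Nat.card P := by
  have := Fintype.ofFinite P
  have hKs : K = Submodule.span ℂ (Set.range fun i : P => b i) := by
    apply le_antisymm
    · intro x hx
      have h := b.hasSum_repr x
      have h0 : ∀ i ∉ P.toFinset, b.repr x i • b i = 0 := by
        intro i hi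
        rw [b.repr_apply_apply, hK x hx i (by simpa using hi), zero_smul]
      rw [h.unique (hasSum_sum_of_ne_finset_zero h0)]
      exact Submodule.sum_mem _ fun i hi => Submodule.smul_mem _ _
        (Submodule.subset_span ⟨⟨i, by simpa using hi⟩, rfl⟩)
    · rw [Submodule.span_le]
      rintro _ ⟨i, rfl⟩
      exact hP i i.2
  rw [hKs]
  refine ⟨FiniteDimensional.span_of_finite ℂ (Set.finite_range _), ?_⟩
  rw [Nat.card_eq_fintype_card]
  exact finrank_span_eq_card (b.orthonormal.linearIndependent.comp _ Subtype.val_injective)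

end HilbertSchmidt

/-! ### The index as a difference of traces. -/

section Index

variable {ι κ E F G G' : Type*} [NormedAddCommGroup E] [InnerProductSpace ℂ E] [CompleteSpace E]
  [NormedAddCommGroup F] [InnerProductSpace ℂ F] [CompleteSpace F]
  [NormedAddCommGroup G] [InnerProductSpace ℂ G] [CompleteSpace G]
  [NormedAddCommGroup G'] [InnerProductSpace ℂ G'] [CompleteSpace G']

/-- A lower bound on (ker T)ᗮ makes the range closed, so the cokernel is the orthogonal complement
of the range, which is ker T*. -/
theorem isFredholm_of_le_norm (T : E →L[ℂ] F) {c : ℝ} (hc : 0 < c)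
    (hT : ∀ x ∈ T.kerᗮ, c * ‖x‖ ≤ ‖T x‖) (h1 : FiniteDimensional ℂ T.ker)
    (h2 : FiniteDimensional ℂ T.adjoint.ker) :
    T.IsFredholm ∧
      T.toLinearMap.index = Module.finrank ℂ T.ker - Module.finrank ℂ T.adjoint.ker := by
  have : CompleteSpace T.kerᗮ := (Submodule.isClosed_orthogonal _).completeSpace_coe
  have hcker : IsClosed (T.ker : Set E) := T.isClosed_ker
  have : CompleteSpace T.ker := hcker.completeSpace_coe
  let R : T.kerᗮ →L[ℂ] F := T ∘L T.kerᗮ.subtypeL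
  have hR : AntilipschitzWith (Real.toNNReal c⁻¹) R := by
    refine AddMonoidHomClass.antilipschitz_of_bound _ fun x => ?_
    rw [Real.coe_toNNReal _ (by positivity), ← div_eq_inv_mul, le_div_iff₀' hc]
    exact hT x x.2
  have hRcl : IsClosed (Set.range R) := hR.isClosed_range R.uniformContinuous
  have hrange : T.range = R.range := by
    apply le_antisymm
    · rintro _ ⟨x, rfl⟩
      have hx : T.ker.starProjection x + T.kerᗮ.starProjection x = x :=
        Submodule.starProjection_add_starProjection_orthogonal x
      refine ⟨⟨T.kerᗮ.starProjection x, Submodule.starProjection_apply_mem _ _⟩, ?_⟩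
      have hk : T (T.ker.starProjection x) = 0 :=
        LinearMap.mem_ker.1 (Submodule.starProjection_apply_mem T.ker x)
      change T (T.kerᗮ.starProjection x) = T x
      nth_rw 2 [← hx]
      rw [map_add, hk, zero_add]
    · rintro _ ⟨x, rfl⟩
      exact ⟨x, rfl⟩
  have hTcl : IsClosed (T.range : Set F) := by rw [hrange]; exact hRcl
  have : CompleteSpace T.range := hTcl.completeSpace_coe
  have horth : T.rangeᗮ = T.adjoint.ker := T.orthogonal_range
  have hfin : FiniteDimensional ℂ T.rangeᗮ := by rw [horth]; exact h2
  have e := Submodule.quotientEquivOfIsCompl T.range T.rangeᗮ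
    (Submodule.isCompl_orthogonal _)
  have e' := Submodule.quotientEquivOfIsCompl T.kerᗮ T.ker
    (Submodule.isCompl_orthogonal _).symm
  have hco : T.range.CoFG := Module.Finite.equiv e.symm
  have hco' : T.kerᗮ.CoFG := Module.Finite.equiv e'.symm
  have hco'' : R.range.CoFG := hrange ▸ hco
  refine ⟨?_, ?_⟩
  · refine ContinuousLinearMap.IsFredholm.of_isInvertible_restrict (E₁ := T.kerᗮ) (F₁ := R.range)
      (Submodule.isClosed_orthogonal _) hRcl (fun x hx => ⟨⟨x, hx⟩, rfl⟩)
      ⟨R.equivRange hR.injective hRcl, ?_⟩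
    ext x
    rfl
  · rw [LinearMap.index_eq_finrank_sub, e.finrank_eq, horth]

/-- Over ℂ an operator is determined by its quadratic form. -/
theorem adjoint_apply_adjoint_add {T : E →L[ℂ] F} {S : E →L[ℂ] G}
    (h : ∀ x, ‖S x‖ ^ 2 + ‖T x‖ ^ 2 = ‖x‖ ^ 2) (x : E) :
    S.adjoint (S x) + T.adjoint (T x) = x := by
  have := (ext_inner_map (S.adjoint ∘L S + T.adjoint ∘L T).toLinearMap LinearMap.id).1 fun y => by
    simp only [ContinuousLinearMap.coe_coe, add_apply,
      ContinuousLinearMap.comp_apply, inner_add_left, ContinuousLinearMap.adjoint_inner_left,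
      inner_self_eq_norm_sq_to_K, LinearMap.id_apply]
    exact_mod_cast h y
  exact LinearMap.congr_fun this x

theorem enorm_sq_eq_one_of_apply_eq_zero {E F G : Type*} [NormedAddCommGroup E] [NormedAddCommGroup F]
    [NormedAddCommGroup G] [InnerProductSpace ℂ E] [InnerProductSpace ℂ F] [InnerProductSpace ℂ G]
    {T : E →L[ℂ] F} {S : E →L[ℂ] G}
    (h : ∀ x, ‖S x‖ ^ 2 + ‖T x‖ ^ 2 = ‖x‖ ^ 2) {x : E} (hx : ‖x‖ = 1) (hT : T x = 0) :
    ‖S x‖ₑ ^ 2 = 1 := by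
  have := h x
  rw [hT, hx] at this
  rw [← ofReal_norm_sq, show ‖S x‖ ^ 2 = 1 by simpa using this, ENNReal.ofReal_one]

theorem finite_of_tsum_one_ne_top {P : Set ι} (h : ∑' _ : P, (1 : ℝ≥0∞) ≠ ∞) : Finite P := by
  by_contra hP
  rw [not_finite_iff_infinite] at hP
  exact h (ENNReal.tsum_const_eq_top_of_ne_zero one_ne_zero)

theorem tsum_one_eq_card (P : Set ι) [Finite P] : ∑' _ : P, (1 : ℝ≥0∞) = Nat.card P := by
  have := Fintype.ofFinite P
  simp [tsum_fintype]

/-- ‖Tx‖² = ∑ ν_i |⟨f_i, x⟩|², and x has no component along the f_i in ker T. -/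
theorem norm_sq_ge_of_mem_orthogonal (f : HilbertBasis ι ℂ E) (T : E →L[ℂ] F) {ν : ι → ℝ}
    (hν : ∀ i, T.adjoint (T (f i)) = (ν i : ℂ) • f i) {c : ℝ}
    (hc : ∀ i, T (f i) ≠ 0 → c ≤ ν i) {x : E} (hx : x ∈ T.kerᗮ) : c * ‖x‖ ^ 2 ≤ ‖T x‖ ^ 2 := by
  have h1 := (hasSum_norm_inner_sq f x).mul_left c
  have h2 := Complex.hasSum_re (f.hasSum_inner_mul_inner x (T.adjoint (T x)))
  rw [ContinuousLinearMap.adjoint_inner_right] at h2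
  have h3 : (inner ℂ (T x) (T x)).re = ‖T x‖ ^ 2 := inner_self_eq_norm_sq (𝕜 := ℂ) _
  rw [h3] at h2
  refine hasSum_le (fun i => ?_) h1 h2
  rw [ContinuousLinearMap.adjoint_inner_right, ← ContinuousLinearMap.adjoint_inner_left, hν,
    inner_smul_left, Complex.conj_ofReal, mul_left_comm, Complex.re_ofReal_mul,
    ← inner_conj_symm x (f i), ← Complex.normSq_eq_conj_mul_self, Complex.ofReal_re,
    Complex.normSq_eq_norm_sq]
  by_cases hi : T (f i) = 0
  · simp [(Submodule.mem_orthogonal _ _).1 hx (f i) (LinearMap.mem_ker.2 hi)]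
  · exact mul_le_mul_of_nonneg_right (hc i hi) (by positivity)

/-- The index of a contraction `T` for which `1 - T* T = S* S` and `1 - T T* = S'* S'` have finite
trace is the difference of these traces. -/
theorem isFredholm_and_index_eq {E : Type u} [NormedAddCommGroup E] [InnerProductSpace ℂ E]
    [CompleteSpace E] (T : E →L[ℂ] F) (S : E →L[ℂ] G) (S' : F →L[ℂ] G')
    (hS : ∀ x, ‖S x‖ ^ 2 + ‖T x‖ ^ 2 = ‖x‖ ^ 2)
    (hS' : ∀ y, ‖S' y‖ ^ 2 + ‖T.adjoint y‖ ^ 2 = ‖y‖ ^ 2)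
    (b : HilbertBasis ι ℂ E) (c : HilbertBasis κ ℂ F)
    (hb : ∑' i, ‖S (b i)‖ₑ ^ 2 ≠ ∞) (hc : ∑' k, ‖S' (c k)‖ₑ ^ 2 ≠ ∞) :
    T.IsFredholm ∧ (∑' i, ‖S (b i)‖ₑ ^ 2).toReal - (∑' k, ‖S' (c k)‖ₑ ^ 2).toReal =
      (T.toLinearMap.index : ℝ) := by
  classical
  have hcomp : IsCompactOperator (S.adjoint ∘L S) :=
    (isCompactOperator_of_tsum_ne_top b S hb).clm_comp S.adjoint
  have hsymm : (S.adjoint ∘L S).IsSymmetric := fun x y => by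
    simp [ContinuousLinearMap.adjoint_inner_left, ContinuousLinearMap.adjoint_inner_right]
  obtain ⟨I, f, μ, hf⟩ := exists_hilbertBasis_eigenvectors hcomp hsymm
  have hfn (i : I) : ‖f i‖ = 1 := f.orthonormal.1 i
  have hTT (i : I) : T.adjoint (T (f i)) = ((‖T (f i)‖ ^ 2 : ℝ) : ℂ) • f i := by
    have h1 : T.adjoint (T (f i)) = (1 - μ i) • f i := by
      have h2 : S.adjoint (S (f i)) = μ i • f i := hf i
      rw [sub_smul, one_smul, ← h2, eq_sub_iff_add_eq', adjoint_apply_adjoint_add hS]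
    have h3 : inner ℂ (f i) (T.adjoint (T (f i))) = ((‖T (f i)‖ ^ 2 : ℝ) : ℂ) := by
      rw [ContinuousLinearMap.adjoint_inner_right, inner_self_eq_norm_sq_to_K]
      simp
    rw [h1, inner_smul_right, inner_self_eq_norm_sq_to_K, hfn] at h3
    rw [h1, ← h3]
    simp
  have hinner (i j : I) : inner ℂ (T (f i)) (T (f j)) =
      ((‖T (f j)‖ ^ 2 : ℝ) : ℂ) * if i = j then 1 else 0 := by
    rw [← ContinuousLinearMap.adjoint_inner_right, hTT, inner_smul_right,
      orthonormal_iff_ite.1 f.orthonormal]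
  rw [tsum_enorm_sq_eq b f] at hb ⊢
  let P : Set I := {i | T (f i) = 0}
  -- These are the images of the f_i under the polar part of T. For i in P the inverse is 0 and g i
  -- = 0; orthonormality is claimed only off P.
  let g : I → F := fun i => ((‖T (f i)‖⁻¹ : ℝ) : ℂ) • T (f i)
  have hgT (i : I) (y : F) : inner ℂ (g i) y = ((‖T (f i)‖⁻¹ : ℝ) : ℂ) * inner ℂ (T (f i)) y := by
    rw [inner_smul_left, Complex.conj_ofReal]
  have hg : Orthonormal ℂ fun i : (Pᶜ : Set I) => g i := by
    rw [orthonormal_iff_ite]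
    rintro ⟨i, hi⟩ ⟨j, hj⟩
    rw [hgT, inner_smul_right, hinner]
    have hj' : ‖T (f j)‖ ≠ 0 := norm_ne_zero_iff.2 hj
    by_cases hij : i = j
    · subst hij
      simp only [if_true, mul_one]
      norm_cast
      field_simp
    · simp [hij]
  obtain ⟨w, c', hsw, hc'⟩ := hg.toSubtypeRange.exists_hilbertBasis_extension
  rw [tsum_enorm_sq_eq c c'] at hc ⊢
  -- The vectors added in completing the g i to a basis; they turn out to span ker T*.
  let P' : Set w := {y | (y : F) ∉ Set.range fun i : (Pᶜ : Set I) => g i}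
  have hTP' : ∀ y ∈ P', T.adjoint (c' y) = 0 := by
    intro y hy
    rw [← norm_eq_zero, ← sq_eq_zero_iff]
    refine (hasSum_norm_inner_sq f _).unique ?_
    convert hasSum_zero with i
    rw [ContinuousLinearMap.adjoint_inner_right]
    by_cases hi : T (f i) = 0
    · simp [hi]
    · have hgi : g i ∈ w := hsw ⟨⟨i, hi⟩, rfl⟩
      have h0 : inner ℂ (c' ⟨g i, hgi⟩) (c' y) = 0 :=
        c'.orthonormal.2 fun h => hy ⟨⟨i, hi⟩, congrArg Subtype.val h⟩
      rw [hc', hgT, mul_eq_zero, ← hc'] at h0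
      rw [h0.resolve_left (by simpa using hi)]
      simp
  -- The cancellation: T*(g i) = ‖T (f i)‖ f_i, so the terms of the two traces at g i and f_i agree.
  have hS'g (i : I) (hi : i ∉ P) : ‖S' (g i)‖ₑ ^ 2 = ‖S (f i)‖ₑ ^ 2 := by
    have hi' : ‖T (f i)‖ ≠ 0 := norm_ne_zero_iff.2 hi
    have h1 : ‖g i‖ = 1 := hg.1 ⟨i, hi⟩
    have h2 : ‖T.adjoint (g i)‖ = ‖T (f i)‖ := by
      rw [map_smul, hTT, smul_smul, norm_smul, hfn, ← Complex.ofReal_mul, Complex.norm_real]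
      rw [mul_one, sq, inv_mul_cancel_left₀ hi', norm_norm]
    have h3 := hS' (g i)
    have h4 := hS (f i)
    rw [h1, h2] at h3
    rw [hfn] at h4
    rw [← ofReal_norm_sq, ← ofReal_norm_sq]
    congr 1
    linarith
  have ha : ∑' i, ‖S (f i)‖ₑ ^ 2 =
      (∑' _ : P, 1) + ∑' i : (Pᶜ : Set I), ‖S (f i)‖ₑ ^ 2 := by
    rw [← ENNReal.summable.tsum_add_tsum_compl (s := P) ENNReal.summable]
    congr 1
    exact tsum_congr fun i => enorm_sq_eq_one_of_apply_eq_zero hS (hfn i) i.2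
  let φ : (Pᶜ : Set I) → (P'ᶜ : Set w) := fun i => ⟨⟨g i, hsw ⟨i, rfl⟩⟩, not_not.2 ⟨i, rfl⟩⟩
  have hφ : Function.Bijective φ := by
    refine ⟨fun i j hij => hg.linearIndependent.injective ?_, fun y => ?_⟩
    · exact congrArg (fun z : (P'ᶜ : Set w) => ((z : w) : F)) hij
    · obtain ⟨i, hi⟩ := not_not.1 y.2
      exact ⟨i, Subtype.ext (Subtype.ext hi)⟩
  have hb' : ∑' k, ‖S' (c' k)‖ₑ ^ 2 =
      (∑' _ : P', 1) + ∑' i : (Pᶜ : Set I), ‖S (f i)‖ₑ ^ 2 := by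
    rw [← ENNReal.summable.tsum_add_tsum_compl (s := P') ENNReal.summable]
    congr 1
    · exact tsum_congr fun k => enorm_sq_eq_one_of_apply_eq_zero hS' (c'.orthonormal.1 k) (hTP' k k.2)
    · rw [← (Equiv.ofBijective φ hφ).tsum_eq]
      refine tsum_congr fun i => ?_
      rw [hc']
      exact hS'g i i.2
  rw [ha] at hb ⊢
  rw [hb'] at hc ⊢
  have hPf : Finite P := finite_of_tsum_one_ne_top fun h => hb (by rw [h, top_add])
  have hPf' : Finite P' := finite_of_tsum_one_ne_top fun h => hc (by rw [h, top_add])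
  have hrest : ∑' i : (Pᶜ : Set I), ‖S (f i)‖ₑ ^ 2 ≠ ∞ := fun h => hb (by rw [h, add_top])
  have hker : FiniteDimensional ℂ T.ker ∧ Module.finrank ℂ T.ker = Nat.card P := by
    refine finrank_eq_card_of_forall_inner_eq_zero f _ P (fun i hi => hi) fun x hx i hi => ?_
    have h1 : inner ℂ (T.adjoint (T (f i))) x = 0 := by
      rw [ContinuousLinearMap.adjoint_inner_left, show T x = 0 from hx, inner_zero_right]
    rw [hTT, inner_smul_left, Complex.conj_ofReal, mul_eq_zero] at h1
    refine h1.resolve_left ?_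
    have : T (f i) ≠ 0 := hi
    simpa using this
  have hker' : FiniteDimensional ℂ T.adjoint.ker ∧
      Module.finrank ℂ T.adjoint.ker = Nat.card P' := by
    refine finrank_eq_card_of_forall_inner_eq_zero c' _ P' hTP' fun x hx k hk => ?_
    obtain ⟨i, hi⟩ := not_not.1 hk
    rw [hc', ← hi]
    dsimp only
    rw [hgT, ← ContinuousLinearMap.adjoint_inner_right, show T.adjoint x = 0 from hx,
      inner_zero_right, mul_zero]
  -- Summability leaves only finitely many i outside P with ‖S (f i)‖² ≥ 1/2. For every other such
  -- i, ‖T (f i)‖² > 1/2.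
  have hlow : ∃ δ > 0, ∀ i, T (f i) ≠ 0 → δ ≤ ‖T (f i)‖ ^ 2 := by
    have hfin : Set.Finite {i : (Pᶜ : Set I) | 2⁻¹ ≤ ‖S (f i)‖ₑ ^ 2} :=
      ENNReal.finite_const_le_of_tsum_ne_top hrest (by simp)
    have hpos : ∀ i : (Pᶜ : Set I), 0 < ‖T (f i)‖ ^ 2 := fun i => by
      have : T (f i) ≠ 0 := i.2
      positivity
    obtain ⟨δ, hδ, hδ'⟩ : ∃ δ > 0, ∀ i ∈ hfin.toFinset, δ ≤ ‖T (f i)‖ ^ 2 := by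
      by_cases hne : hfin.toFinset.Nonempty
      · obtain ⟨i, -, hi⟩ := hfin.toFinset.exists_min_image (fun i => ‖T (f i)‖ ^ 2) hne
        exact ⟨_, hpos i, hi⟩
      · exact ⟨1, one_pos, fun i hi => (hne ⟨i, hi⟩).elim⟩
    refine ⟨min δ (1 / 2), by positivity, fun i hi => ?_⟩
    by_cases hi2 : 2⁻¹ ≤ ‖S (f i)‖ₑ ^ 2
    · exact (min_le_left _ _).trans (hδ' ⟨i, hi⟩ (hfin.mem_toFinset.2 hi2))
    · refine (min_le_right _ _).trans ?_
      have h4 := hS (f i)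
      rw [hfn] at h4
      rw [not_le, ← ofReal_norm_sq, show (2⁻¹ : ℝ≥0∞) = ENNReal.ofReal (1 / 2) by
        rw [one_div, ENNReal.ofReal_inv_of_pos two_pos]; simp,
        ENNReal.ofReal_lt_ofReal_iff (by norm_num)] at hi2
      linarith
  obtain ⟨δ, hδ, hδ'⟩ := hlow
  have hfred := isFredholm_of_le_norm T (Real.sqrt_pos.2 hδ) (fun x hx => by
    rw [← abs_of_nonneg (norm_nonneg (T x))]
    refine Real.le_sqrt_of_sq_le ?_ |>.trans (Real.sqrt_sq_eq_abs _).le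
    rw [mul_pow, Real.sq_sqrt hδ.le]
    exact norm_sq_ge_of_mem_orthogonal f T hTT hδ' hx) hker.1 hker'.1
  refine ⟨hfred.1, ?_⟩
  rw [hfred.2, hker.2, hker'.2, tsum_one_eq_card, tsum_one_eq_card,
    ENNReal.toReal_add (by simp) hrest, ENNReal.toReal_add (by simp) hrest]
  simp

end Index

/-! ### Fredholm operators under isomorphisms. -/

section Fredholm

variable {E E' F F' : Type*} [NormedAddCommGroup E] [NormedSpace ℂ E] [NormedAddCommGroup F]
  [NormedSpace ℂ F] [NormedAddCommGroup E'] [NormedSpace ℂ E'] [NormedAddCommGroup F']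
  [NormedSpace ℂ F']

theorem isFredholm_equiv_comp {T : E →L[ℂ] F} (hT : T.IsFredholm) (e : E' ≃L[ℂ] E)
    (e' : F ≃L[ℂ] F') :
    ((e' : F →L[ℂ] F') ∘L T ∘L (e : E' →L[ℂ] E)).IsFredholm ∧
      ((e' : F →L[ℂ] F') ∘L T ∘L (e : E' →L[ℂ] E)).toLinearMap.index = T.toLinearMap.index := by
  constructor
  · obtain ⟨R, hR⟩ := hT.exists_isQuasiInverse
    refine ContinuousLinearMap.IsFredholm.of_isQuasiInverse
      (v := (e.symm : E →L[ℂ] E') ∘L R ∘L (e'.symm : F' →L[ℂ] F)) ?_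
    exact (e.toLinearEquiv.isQuasiInverse.comp hR).comp e'.toLinearEquiv.isQuasiInverse
  · let A := e.toLinearEquiv
    let B := e'.toLinearEquiv
    have := hT.finite_ker
    have : FiniteDimensional ℂ (F ⧸ T.range) := hT.finite_coker
    have : FiniteDimensional ℂ A.toLinearMap.ker := by rw [A.ker]; infer_instance
    have : FiniteDimensional ℂ B.toLinearMap.ker := by rw [B.ker]; infer_instance
    have : FiniteDimensional ℂ (E ⧸ A.toLinearMap.range) := by rw [A.range]; infer_instance
    have : FiniteDimensional ℂ (F' ⧸ B.toLinearMap.range) := by rw [B.range]; infer_instance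
    have : FiniteDimensional ℂ (T.toLinearMap ∘ₗ A.toLinearMap).ker := by
      rw [LinearMap.ker_comp]
      rw [Submodule.comap_equiv_eq_map_symm]
      infer_instance
    have : FiniteDimensional ℂ (F ⧸ (T.toLinearMap ∘ₗ A.toLinearMap).range) := by
      rw [LinearMap.range_comp_of_range_eq_top _ A.range]; infer_instance
    change (B.toLinearMap ∘ₗ T.toLinearMap ∘ₗ A.toLinearMap).index = _
    rw [LinearMap.index_comp, LinearMap.index_comp, LinearEquiv.index_eq_zero,
      LinearEquiv.index_eq_zero, zero_add, add_zero]

/-- Rules out the mixed case, one range finite-dimensional and the other not, which `HasEssCodim`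
does not cover. -/
theorem finiteDimensional_iff_of_isFredholm {T : E →L[ℂ] F} (hT : T.IsFredholm) :
    FiniteDimensional ℂ E ↔ FiniteDimensional ℂ F := by
  have := hT.finite_ker
  have : FiniteDimensional ℂ (F ⧸ T.range) := hT.finite_coker
  constructor
  · intro h
    have : FiniteDimensional ℂ T.range := inferInstanceAs (FiniteDimensional ℂ T.toLinearMap.range)
    exact Module.Finite.of_submodule_quotient T.range
  · intro h
    have : FiniteDimensional ℂ (E ⧸ T.ker) := T.toLinearMap.quotKerEquivRange.symm.finiteDimensional
    exact Module.Finite.of_submodule_quotient T.ker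

end Fredholm

/-! ### Reindexing bases and identifying subspaces with the whole space. -/

section Basis

variable {ι κ E : Type*} [NormedAddCommGroup E] [InnerProductSpace ℂ E]

theorem exists_hilbertBasis_comp_equiv [CompleteSpace E] (b : HilbertBasis ι ℂ E) (σ : κ ≃ ι) :
    ∃ c : HilbertBasis κ ℂ E, ⇑c = b ∘ σ := by
  refine ⟨HilbertBasis.mk (b.orthonormal.comp σ σ.injective) ?_, HilbertBasis.coe_mk _ _⟩
  rw [σ.surjective.range_comp, b.dense_span]

theorem isHilbertSchmidt_of_tsum_ne_top [CompleteSpace E] (b : HilbertBasis ι ℂ E) (T : E →L[ℂ] E)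
    (h : ∑' i, ‖T (b i)‖ₑ ^ 2 ≠ ∞) : IsHilbertSchmidt T := by
  obtain ⟨w, c, -⟩ := exists_hilbertBasis ℂ E
  refine ⟨w, c, ?_⟩
  rw [tsum_enorm_sq_eq b c] at h
  simpa using ENNReal.summable_toReal h

theorem nonempty_linearIsometryEquiv (e : HilbertBasis ℕ ℂ E) (K : Submodule ℂ E)
    [CompleteSpace K] (hK : ¬ FiniteDimensional ℂ K) : Nonempty (E ≃ₗᵢ[ℂ] K) := by
  obtain ⟨w, b, -⟩ := exists_hilbertBasis ℂ K
  have : Infinite w := by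
    rw [← not_finite_iff_infinite]
    intro hw
    have := (finrank_eq_card_of_forall_inner_eq_zero b ⊤ Set.univ (fun _ _ => trivial)
      fun _ _ i hi => (hi trivial).elim).1
    exact hK (Submodule.topEquiv.finiteDimensional (V := (⊤ : Submodule ℂ K)))
  have : Countable w := by
    rw [← Set.countable_univ_iff]
    -- Each projected e j has countably many nonzero coefficients in b, and a b k missed by all of
    -- them would be orthogonal to every e j.
    refine (Set.countable_iUnion fun j : ℕ =>
      (hasSum_norm_inner_sq b (K.orthogonalProjectionOnto (e j))).summable.countable_support).mono
      fun k _ => ?_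
    by_contra hk
    simp only [Set.mem_iUnion, Function.mem_support, not_exists, not_not] at hk
    refine b.orthonormal.ne_zero k ?_
    rw [← Submodule.coe_eq_zero, ← norm_eq_zero, ← sq_eq_zero_iff]
    refine (hasSum_norm_inner_sq e _).unique ?_
    convert hasSum_zero with j
    have := hk j
    rwa [Submodule.inner_orthogonalProjectionOnto_eq_of_mem_left, norm_inner_symm] at this
  obtain ⟨σ⟩ := nonempty_equiv_of_countable (α := ℕ) (β := w)
  obtain ⟨c, -⟩ := exists_hilbertBasis_comp_equiv b σ
  exact ⟨e.repr.trans c.repr.symm⟩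

end Basis

/-! ### Pairs of projections and the operator q|_{pH}. -/

section Projections

variable {H : Type*} [NormedAddCommGroup H] [InnerProductSpace ℂ H] [CompleteSpace H]
  {p q : H →L[ℂ] H}

theorem inner_starProjection_apply (hp : IsStarProjection p) (x y : H) :
    inner ℂ (p x) y = inner ℂ x (p y) := by
  rw [← ContinuousLinearMap.adjoint_inner_right, hp.isSelfAdjoint.adjoint_eq]

theorem starProjection_apply_apply (hp : IsStarProjection p) (x : H) : p (p x) = p x :=
  DFunLike.congr_fun hp.isIdempotentElem.eq x

theorem starProjection_apply_of_mem (hp : IsStarProjection p) {x : H} (hx : x ∈ p.range) :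
    p x = x := by
  obtain ⟨y, rfl⟩ := hx
  exact starProjection_apply_apply hp y

theorem completeSpace_range (hp : IsStarProjection p) : CompleteSpace p.range := by
  have : (p.range : Set H) = {x | p x = x} :=
    Set.ext fun x => ⟨starProjection_apply_of_mem hp, fun h => ⟨x, h⟩⟩
  have hcl : IsClosed (p.range : Set H) := by
    rw [this]
    exact isClosed_eq p.continuous continuous_id
  exact hcl.completeSpace_coe

theorem norm_sq_starProjection_apply (hp : IsStarProjection p) (x : H) :
    ‖p x‖ ^ 2 = (inner ℂ x (p x)).re := by
  rw [← starProjection_apply_apply hp x, ← inner_starProjection_apply hp,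
    starProjection_apply_apply hp]
  exact (inner_self_eq_norm_sq (𝕜 := ℂ) _).symm

theorem norm_sub_sq_add_norm_sq (hp : IsStarProjection p) (x : H) :
    ‖x - p x‖ ^ 2 + ‖p x‖ ^ 2 = ‖x‖ ^ 2 := by
  have h := norm_sub_sq (𝕜 := ℂ) x (p x)
  have h' := norm_sq_starProjection_apply hp x
  simp only [RCLike.re_to_complex] at h
  linarith

theorem adjoint_restrictRange [CompleteSpace p.range] [CompleteSpace q.range]
    (hp : IsStarProjection p) (hq : IsStarProjection q) :
    (restrictRange p q).adjoint = restrictRange q p := by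
  symm
  rw [ContinuousLinearMap.eq_adjoint_iff]
  intro y x
  change inner ℂ (p (y : H)) (x : H) = inner ℂ (y : H) (q (x : H))
  rw [inner_starProjection_apply hp, starProjection_apply_of_mem hp x.2,
    ← inner_starProjection_apply hq, starProjection_apply_of_mem hq y.2]

/-- The adjoint of (1-q)|_{pH} is p(1-q), viewed as a map to pH; passing to it trades a basis of pH
for one of H. -/
theorem tsum_starProjection_sub_eq {ι κ : Type*} [CompleteSpace p.range] (hp : IsStarProjection p)
    (hq : IsStarProjection q) (e : HilbertBasis ι ℂ H) (c : HilbertBasis κ ℂ p.range) :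
    ∑' k, ‖(c k : H) - q (c k)‖ₑ ^ 2 = ∑' j, ‖p (e j - q (e j))‖ₑ ^ 2 := by
  let S : p.range →L[ℂ] H := (ContinuousLinearMap.id ℂ H - q) ∘L p.range.subtypeL
  have h := tsum_enorm_adjoint_sq c e S
  have hS (x : H) : ‖S.adjoint x‖ₑ = ‖p (x - q x)‖ₑ := by
    have : S.adjoint = p.rangeRestrict ∘L (ContinuousLinearMap.id ℂ H - q) := by
      symm
      rw [ContinuousLinearMap.eq_adjoint_iff]
      intro x y
      change inner ℂ (p (x - q x)) (y : H) = inner ℂ x ((y : H) - q y)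
      rw [inner_starProjection_apply hp, starProjection_apply_of_mem hp y.2, inner_sub_left,
        inner_sub_right, inner_starProjection_apply hq]
    rw [this]
    rfl
  simp only [hS] at h
  exact h.symm

/-- The operators q(1-p) and (1-p)q are adjoint to each other. -/
theorem tsum_sub_starProjection_comm {ι : Type*} (hp : IsStarProjection p)
    (hq : IsStarProjection q) (e : HilbertBasis ι ℂ H) :
    ∑' j, ‖q (e j - p (e j))‖ₑ ^ 2 = ∑' j, ‖q (e j) - p (q (e j))‖ₑ ^ 2 := by
  have h := tsum_enorm_adjoint_sq e e (q ∘L (1 - p))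
  have h1 : (1 - p).adjoint = 1 - p := hp.one_sub.isSelfAdjoint.adjoint_eq
  rw [ContinuousLinearMap.adjoint_comp, h1, hq.isSelfAdjoint.adjoint_eq] at h
  exact h.symm

theorem exists_isometry_comp_adjoint_eq (e : HilbertBasis ℕ ℂ H) (hp : IsStarProjection p)
    (h : ¬ FiniteDimensional ℂ p.range) :
    ∃ (U : H ≃ₗᵢ[ℂ] p.range) (w : H →L[ℂ] H), Isometry w ∧ w ∘L w.adjoint = p ∧
      (∀ x, w x = U x) ∧ ∀ x, w.adjoint x = U.symm (p.rangeRestrict x) := by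
  have := completeSpace_range hp
  obtain ⟨U⟩ := nonempty_linearIsometryEquiv e p.range h
  let w : H →L[ℂ] H := p.range.subtypeL ∘L (U : H →L[ℂ] p.range)
  have hw : w.adjoint = (U.symm : p.range →L[ℂ] H) ∘L p.rangeRestrict := by
    symm
    rw [ContinuousLinearMap.eq_adjoint_iff]
    intro x y
    change inner ℂ (U.symm (p.rangeRestrict x)) y = inner ℂ x (U y : H)
    rw [← U.inner_map_map, U.apply_symm_apply]
    change inner ℂ (p x) (U y : H) = inner ℂ x (U y : H)
    rw [inner_starProjection_apply hp, starProjection_apply_of_mem hp (U y).2]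
  refine ⟨U, w, isometry_subtype_coe.comp U.isometry, ?_, fun x => rfl, fun x => by rw [hw]; rfl⟩
  ext x
  rw [hw]
  change ((U (U.symm (p.rangeRestrict x)) : p.range) : H) = p x
  rw [U.apply_symm_apply]
  rfl

/-- In the infinite case v*w = V⁻¹ ∘ q|_{pH} ∘ U for unitaries U : H → pH and V : H → qH. -/
theorem hasEssCodim_index (e : HilbertBasis ℕ ℂ H) (hp : IsStarProjection p)
    (hq : IsStarProjection q) (hpq : IsCompactOperator (p - q))
    (hT : (restrictRange p q).IsFredholm) :
    HasEssCodim p q (restrictRange p q).toLinearMap.index := by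
  refine ⟨hpq, ?_⟩
  by_cases h : FiniteDimensional ℂ p.range
  · have h' := (finiteDimensional_iff_of_isFredholm hT).1 h
    exact .inl ⟨h, h', LinearMap.index_eq_of_finiteDimensional⟩
  · have h' := mt (finiteDimensional_iff_of_isFredholm hT).2 h
    obtain ⟨U, w, hw, hwp, hU, -⟩ := exists_isometry_comp_adjoint_eq e hp h
    obtain ⟨V, v, hv, hvq, -, hV⟩ := exists_isometry_comp_adjoint_eq e hq h'
    have hvw : v.adjoint ∘L w = (V.symm.toContinuousLinearEquiv : q.range →L[ℂ] H) ∘L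
        restrictRange p q ∘L (U.toContinuousLinearEquiv : H →L[ℂ] p.range) := by
      ext x
      change v.adjoint (w x) = V.symm (restrictRange p q (U x))
      rw [hV, hU]
      rfl
    have := isFredholm_equiv_comp hT U.toContinuousLinearEquiv V.symm.toContinuousLinearEquiv
    rw [← hvw] at this
    exact .inr ⟨h, h', w, v, hw, hv, hwp, hvq, this.1, this.2.symm⟩

theorem isFredholm_restrictRange {ι : Type*} (hp : IsStarProjection p) (hq : IsStarProjection q)
    (e : HilbertBasis ι ℂ H) (ha : ∑' j, ‖p (e j - q (e j))‖ₑ ^ 2 ≠ ∞)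
    (hb : ∑' j, ‖q (e j - p (e j))‖ₑ ^ 2 ≠ ∞) :
    (restrictRange p q).IsFredholm ∧
      (∑' j, ‖p (e j - q (e j))‖ₑ ^ 2).toReal - (∑' j, ‖q (e j - p (e j))‖ₑ ^ 2).toReal =
        ((restrictRange p q).toLinearMap.index : ℝ) := by
  have := completeSpace_range hp
  have := completeSpace_range hq
  obtain ⟨_, c, -⟩ := exists_hilbertBasis ℂ p.range
  obtain ⟨_, c', -⟩ := exists_hilbertBasis ℂ q.range
  rw [← tsum_starProjection_sub_eq hp hq e c] at ha ⊢
  rw [← tsum_starProjection_sub_eq hq hp e c'] at hb ⊢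
  exact isFredholm_and_index_eq (restrictRange p q)
    ((ContinuousLinearMap.id ℂ H - q) ∘L p.range.subtypeL)
    ((ContinuousLinearMap.id ℂ H - p) ∘L q.range.subtypeL)
    (fun x => norm_sub_sq_add_norm_sq hq x)
    (fun y => by
      rw [adjoint_restrictRange hp hq]
      exact norm_sub_sq_add_norm_sq hp y) c c' ha hb

end Projections

/-! ### The diagonal sums a and b as Hilbert–Schmidt sums. -/

section Diagonal

variable {H : Type*} [NormedAddCommGroup H] [InnerProductSpace ℂ H] [CompleteSpace H]
  (e : HilbertBasis ℕ ℂ H) {p : H →L[ℂ] H}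

theorem isStarProjection_largeDiagProj (p : H →L[ℂ] H) : IsStarProjection (largeDiagProj e p) :=
  isStarProjection_starProjection

theorem largeDiagProj_apply_of_lt {j : ℕ} (hj : 1 / 2 < diag e p j) :
    largeDiagProj e p (e j) = e j :=
  Submodule.starProjection_eq_self_iff.2
    (Submodule.le_topologicalClosure _ (Submodule.subset_span ⟨j, hj, rfl⟩))

theorem largeDiagProj_apply_of_le {j : ℕ} (hj : diag e p j ≤ 1 / 2) :
    largeDiagProj e p (e j) = 0 := by
  refine (Submodule.starProjection_apply_eq_zero_iff _).2 ?_
  rw [Submodule.orthogonal_closure, Submodule.mem_orthogonal]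
  intro x hx
  induction hx using Submodule.span_induction with
  | mem x hx =>
    obtain ⟨i, hi, rfl⟩ := hx
    exact e.orthonormal.2 fun h => not_lt.2 hj (h ▸ hi)
  | zero => exact inner_zero_left _
  | add x y _ _ hx hy => rw [inner_add_left, hx, hy, add_zero]
  | smul c x _ hx => rw [inner_smul_left, hx, mul_zero]

/-- 1 - q keeps e_j when d_j ≤ 1/2 and kills it otherwise, and ‖p e_j‖² = d_j. The value 1/2 plays
no role beyond splitting the basis. -/
theorem kadisonA_eq (hp : IsStarProjection p) : kadisonA e p =
    ∑' j, ‖p (e j - largeDiagProj e p (e j))‖ₑ ^ 2 := by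
  refine (tsum_subtype {j | diag e p j ≤ 1 / 2} fun j => ENNReal.ofReal (diag e p j)).trans ?_
  refine tsum_congr fun j => ?_
  by_cases hj : diag e p j ≤ 1 / 2
  · rw [Set.indicator_of_mem (by exact hj), largeDiagProj_apply_of_le e hj, sub_zero, diag,
      ← norm_sq_starProjection_apply hp, ofReal_norm_sq]
  · rw [Set.indicator_of_notMem (by exact hj), largeDiagProj_apply_of_lt e (not_le.1 hj)]
    simp

theorem kadisonB_eq (hp : IsStarProjection p) : kadisonB e p =
    ∑' j, ‖largeDiagProj e p (e j) - p (largeDiagProj e p (e j))‖ₑ ^ 2 := by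
  refine (tsum_subtype {j | 1 / 2 < diag e p j}
    fun j => ENNReal.ofReal (1 - diag e p j)).trans ?_
  refine tsum_congr fun j => ?_
  by_cases hj : 1 / 2 < diag e p j
  · rw [Set.indicator_of_mem (by exact hj), largeDiagProj_apply_of_lt e hj, ← ofReal_norm_sq]
    have h := norm_sub_sq_add_norm_sq hp (e j)
    rw [norm_sq_starProjection_apply hp, e.orthonormal.1 j] at h
    rw [diag]
    congr 1
    linarith
  · rw [Set.indicator_of_notMem (by exact hj), largeDiagProj_apply_of_le e (not_lt.1 hj)]
    simp

theorem tsum_enorm_sub_largeDiagProj_sq (hp : IsStarProjection p) :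
    ∑' j, ‖(p - largeDiagProj e p) (e j)‖ₑ ^ 2 = kadisonA e p + kadisonB e p := by
  rw [kadisonA_eq e hp, kadisonB_eq e hp, ← ENNReal.tsum_add]
  refine tsum_congr fun j => ?_
  rw [sub_apply]
  by_cases hj : 1 / 2 < diag e p j
  · rw [largeDiagProj_apply_of_lt e hj, enorm_sub_rev]
    simp
  · rw [largeDiagProj_apply_of_le e (not_lt.1 hj)]
    simp

end Diagonal

end EssCodim

theorem theorem3 {H : Type*} [NormedAddCommGroup H] [InnerProductSpace ℂ H] [CompleteSpace H]
    (e : HilbertBasis ℕ ℂ H) (p q : H →L[ℂ] H) (hp : IsStarProjection p)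
    (hab : EssCodim.kadisonA e p + EssCodim.kadisonB e p < ∞)
    (hq : q = EssCodim.largeDiagProj e p) :
    EssCodim.IsHilbertSchmidt (p - q) ∧
      (EssCodim.restrictRange p q).IsFredholm ∧
      ∃ n : ℤ, EssCodim.HasEssCodim p q n ∧
        n = (EssCodim.restrictRange p q).toLinearMap.index ∧
        (EssCodim.kadisonA e p).toReal - (EssCodim.kadisonB e p).toReal = (n : ℝ) := by
  have hqp : IsStarProjection q := hq ▸ EssCodim.isStarProjection_largeDiagProj e p
  have hpq : ∑' j, ‖(p - q) (e j)‖ₑ ^ 2 ≠ ∞ := by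
    rw [hq, EssCodim.tsum_enorm_sub_largeDiagProj_sq e hp]
    exact hab.ne
  have ha : EssCodim.kadisonA e p = ∑' j, ‖p (e j - q (e j))‖ₑ ^ 2 :=
    hq ▸ EssCodim.kadisonA_eq e hp
  have hb : EssCodim.kadisonB e p = ∑' j, ‖q (e j - p (e j))‖ₑ ^ 2 := by
    rw [EssCodim.kadisonB_eq e hp, ← hq]
    exact (EssCodim.tsum_sub_starProjection_comm hp hqp e).symm
  obtain ⟨ha', hb'⟩ := ENNReal.add_lt_top.1 hab
  have hT := EssCodim.isFredholm_restrictRange hp hqp e (ha ▸ ha'.ne) (hb ▸ hb'.ne)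
  refine ⟨EssCodim.isHilbertSchmidt_of_tsum_ne_top e _ hpq, hT.1, _,
    EssCodim.hasEssCodim_index e hp hqp (EssCodim.isCompactOperator_of_tsum_ne_top e _ hpq) hT.1,
    rfl, ?_⟩
  rw [ha, hb]
  exact hT.2
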